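/- Let $n>2$ be an integer and index coordinates by $0,1,\dots,n-1$. For a nonzero $\mathbf{x}\in\mathbb{R}^n$ with entries sorted by descending magnitude, $|x_{\pi(0)}|\ge|x_{\pi(1)}|\ge\dots\ge|x_{\pi(n-1)}|$, and $0\le m<n$, the $m$-height of $\mathbf{x}$ is $\mathsf{h}_m(\mathbf{x})=|x_{\pi(0)}/x_{\pi(m)}|$ (which is $\infty$ if $x_{\pi(m)}=0$). The $m$-height of a linear code $\mathcal{C}\subseteq\mathbb{R}^n$ is $\mathsf{h}_m(\mathcal{C})=\max_{\mathbf{c}\in\mathcal{C}\setminus\{\mathbf{0}\}}\mathsf{h}_m(\mathbf{c})$, and a nonzero codeword $\mathbf{c}\in\mathcal{C}$ is $m$-extremal if $\mathsf{h}_m(\mathbf{c})=\mathsf{h}_m(\mathcal{C})$. Put $\beta=\pi/(2n)$, $\omega=e^{\imath\pi/n}$, and let $\mathcal{C}^\perp(n)$ be the dual (with respect to the standard dot product) of the code $\mathcal{C}(n)=\{\mathbf{c}\in\mathbb{R}^n:\sum_{j=0}^{n-1}c_j\omega^j=0\}$. Then $\mathcal{C}^\perp(n)$ is a linear $[n,2,n-1]$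 code over $\mathbb{R}$, with the $2\times n$ generator matrix $G$ whose columns are $\mathbf{g}_j=(\cos(2j\beta),\sin(2j\beta))^\top$, $0\le j<n$. The $2n$ points $\pm\mathbf{g}_j$ are distinct and are the vertices $(\cos(2k\beta),\sin(2k\beta))$, $0\le k<2n$, of a regular $2n$-gon. For every integer $0\le m\le n-2$, $$\mathsf{h}_m(\mathcal{C}^\perp(n))=\begin{cases}\dfrac{1}{\cos((m+1)\beta)},&m\text{ odd},\\[2ex]\dfrac{\cos\beta}{\cos((m+1)\beta)},&m\text{ even}.\end{cases}$$ Moreover, the codeword $\mathbf{c}_1=(1\;\;0)\,G$ and each of its negacyclic shifts is $m$-extremal for every odd $m$ in this range, and the codeword $\mathbf{c}_2=(\cos\beta\;\;\sin\beta)\,G$ and each of its negacyclic shifts is $m$-extremal for every even $m$ in this range, where the negacyclic shifts of a vector are obtained by iterating the map $(c_0,\dots,c_{n-1})\mapsto(-c_{n-1},c_0,\dots,c_{n-2})$. Finally, for $1\le m\le n-2$ and $\mathbf{u}\in\mathbb{R}^2$, the vector $\mathbf{u}G$ is an $m$-extremal codeword if and only if $\mathbf{u}$ points toward (i.e., is a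 positive multiple of) a vertex of the $2n$-gon when $m$ is odd, respectively the midpoint of an edge of the $2n$-gon when $m$ is even. -/

import Mathlib

noncomputable section

namespace HeightProfile

open Matrix

/-- `π` is a sorting permutation of `x`: it lists the entries of `x` by descending magnitudes. -/
def IsSortingPerm {n : ℕ} (x : Fin n → ℝ) (π : Equiv.Perm (Fin n)) : Prop :=
  Antitone fun i => |x (π i)|

/-- A particular sorting permutation of `x`. -/
def sortingPerm {n : ℕ} (x : Fin n → ℝ) : Equiv.Perm (Fin n) :=
  Tuple.sort fun j => -|x j|

/-- The `m`-height `|x_{π(0)}| / |x_{π(m)}|` of a nonzero vector `x`, as an extended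
nonnegative real: it is `∞` when `x_{π(m)} = 0`. -/
def vecHeight {n : ℕ} (m : Fin n) (x : Fin n → ℝ) : ENNReal :=
  ENNReal.ofReal |x (sortingPerm x ⟨0, m.pos⟩)| / ENNReal.ofReal |x (sortingPerm x m)|

theorem isSortingPerm_sortingPerm {n : ℕ} (x : Fin n → ℝ) :
    IsSortingPerm x (sortingPerm x) := by
  intro i j hij
  have h := Tuple.monotone_sort (fun j => -|x j|) hij
  simpa [sortingPerm] using h

theorem IsSortingPerm.abs_apply_eq {n : ℕ} {x : Fin n → ℝ} {π : Equiv.Perm (Fin n)}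
    (h : IsSortingPerm x π) (i : Fin n) : |x (π i)| = |x (sortingPerm x i)| := by
  have hm : Monotone ((fun j => -|x j|) ∘ π) := fun a b hab => neg_le_neg (h hab)
  have := congrFun (Tuple.comp_sort_eq_comp_iff_monotone.mpr hm) i
  simpa [sortingPerm] using this

/-- The `m`-height does not depend on the sorting permutation that is used. -/
theorem vecHeight_eq {n : ℕ} (m : Fin n) {x : Fin n → ℝ} {π : Equiv.Perm (Fin n)}
    (h : IsSortingPerm x π) :
    vecHeight m x = ENNReal.ofReal |x (π ⟨0, m.pos⟩)| / ENNReal.ofReal |x (π m)| := by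
  rw [vecHeight, h.abs_apply_eq, h.abs_apply_eq]

/-- The `m`-height of a linear code `C ⊆ ℝⁿ`: the largest `m`-height of a nonzero codeword. -/
def codeHeight {n : ℕ} (m : Fin n) (C : Submodule ℝ (Fin n → ℝ)) : ENNReal :=
  ⨆ c ∈ {c : Fin n → ℝ | c ∈ C ∧ c ≠ 0}, vecHeight m c

/-- An `m`-extremal codeword: a nonzero codeword whose `m`-height is that of the code. -/
def IsExtremal {n : ℕ} (m : Fin n) (C : Submodule ℝ (Fin n → ℝ)) (c : Fin n → ℝ) : Prop :=
  c ∈ C ∧ c ≠ 0 ∧ vecHeight m c = codeHeight m C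

/-- `C` is a linear `[n,k,d]` code over `ℝ`: length `n`, dimension `k`, minimum distance `d`
(the minimum Hamming weight of a nonzero codeword). -/
def IsLinearCode (n k d : ℕ) (C : Submodule ℝ (Fin n → ℝ)) : Prop :=
  Module.finrank ℝ C = k ∧ IsLeast {w : ℕ | ∃ c ∈ C, c ≠ 0 ∧ hammingNorm c = w} d

/-- The dual code, with respect to the standard dot product. -/
def dual {n : ℕ} (C : Submodule ℝ (Fin n → ℝ)) : Submodule ℝ (Fin n → ℝ) where
  carrier := {x | ∀ c ∈ C, x ⬝ᵥ c = 0}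
  zero_mem' := fun c _ => zero_dotProduct c
  add_mem' := fun {x y} hx hy c hc => by rw [add_dotProduct, hx c hc, hy c hc, add_zero]
  smul_mem' := fun a x hx c hc => by rw [smul_dotProduct, hx c hc, smul_zero]

/-- The rows of `G` form a basis of `C`. -/
def IsGeneratorMatrix {n k : ℕ} (G : Matrix (Fin k) (Fin n) ℝ)
    (C : Submodule ℝ (Fin n → ℝ)) : Prop :=
  LinearIndependent ℝ G.row ∧ Submodule.span ℝ (Set.range G.row) = C

/-- The negacyclic code `C(n) = {c ∈ ℝⁿ : ∑ⱼ cⱼ ωʲ = 0}`, where `ω = exp(iπ/n)` is a complex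
primitive `2n`-th root of unity. -/
def negacyclicCode (n : ℕ) : Submodule ℝ (Fin n → ℝ) where
  carrier := {c | ∑ j : Fin n,
    (c j : ℂ) * Complex.exp (Complex.I * ((Real.pi / n : ℝ) : ℂ)) ^ (j : ℕ) = 0}
  zero_mem' := by simp
  add_mem' := fun {x y} hx hy => by
    simp only [Set.mem_setOf_eq, Pi.add_apply, Complex.ofReal_add, add_mul,
      Finset.sum_add_distrib] at *
    rw [hx, hy, add_zero]
  smul_mem' := fun a x hx => by
    simp only [Set.mem_setOf_eq, Pi.smul_apply, smul_eq_mul, Complex.ofReal_mul, mul_assoc,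
      ← Finset.mul_sum] at *
    rw [hx, mul_zero]

/-- The point of the unit circle at angle `kπ/n`. For `k = 0, …, 2n - 1` these are, in cyclic
order, the vertices of a regular `2n`-gon. -/
def circlePoint (n k : ℕ) : Fin 2 → ℝ :=
  ![Real.cos (k * (Real.pi / n)), Real.sin (k * (Real.pi / n))]

/-- The `2 × n` matrix with columns `gⱼ = (cos(jπ/n), sin(jπ/n))`, `0 ≤ j < n`. -/
def genMatrix (n : ℕ) : Matrix (Fin 2) (Fin n) ℝ :=
  Matrix.of fun i j => circlePoint n j i

/-- The multiset that consists of the columns of `G` and of their negatives. -/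
def signedColumns {n k : ℕ} (G : Matrix (Fin k) (Fin n) ℝ) : Multiset (Fin k → ℝ) :=
  (Finset.univ.val.map fun j : Fin n => G.col j) +
    (Finset.univ.val.map fun j : Fin n => -G.col j)

/-- `u` is a positive multiple of `p`. -/
def PointsToward (u p : Fin 2 → ℝ) : Prop :=
  ∃ t : ℝ, 0 < t ∧ u = t • p

/-- `u` points toward a vertex of the regular `2n`-gon. -/
def PointsTowardVertex (n : ℕ) (u : Fin 2 → ℝ) : Prop :=
  ∃ k < 2 * n, PointsToward u (circlePoint n k)

/-- `u` points toward the midpoint of an edge (between consecutive vertices) of the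
regular `2n`-gon. -/
def PointsTowardEdgeMidpoint (n : ℕ) (u : Fin 2 → ℝ) : Prop :=
  ∃ k < 2 * n, PointsToward u (midpoint ℝ (circlePoint n k) (circlePoint n (k + 1)))

/-- The negacyclic shift `(c₀, …, cₙ₋₁) ↦ (-cₙ₋₁, c₀, …, cₙ₋₂)`. -/
def negacyclicShift {n : ℕ} (c : Fin n → ℝ) : Fin n → ℝ := fun j =>
  if (j : ℕ) = 0 then -c ⟨n - 1, Nat.sub_lt j.pos Nat.one_pos⟩
  else c ⟨(j : ℕ) - 1, lt_of_le_of_lt (Nat.sub_le _ _) j.isLt⟩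

end HeightProfile

end

open HeightProfile

/-!
A nonzero word of the dual code is `u G` with `u = r (cos θ, sin θ)`; its `j`-th entry is
`r cos (θ - 2jβ)`. The dual code is the row space of `G` because a functional that vanishes on the
common kernel of the two rows is a combination of them (`mem_dual_iff`).

Up to sign the `j`-th entry depends on `j` modulo `n` only. Let `2kβ` be the multiple of `2β` nearest
to `θ`, at distance `φ ≤ β`. Visiting the indices in the order `k, k ± 1, k ∓ 1, …` lists the
magnitudes as `r cos αᵢ`, where `αᵢ = iβ + φ` for even `i` and `αᵢ = (i + 1)β - φ` for odd `i`
(`exists_perm_abs_vecMul`). As `αᵢ` lies between `iβ` and `(i + 1)β`, the list is sorted, and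
the `m`-height is `cos φ / cos αₘ` (`vecHeight_vecMul`). At most the last entry vanishes, which gives
the minimum distance `n - 1`.

It remains to maximize over `φ ∈ [0, β]`. By the addition formulas the difference
`1 / cos ((m + 1)β) - cos φ / cos αₘ` for odd `m` has the sign of `sin ((m + 1)β) sin φ`, and
`cos β / cos ((m + 1)β) - cos φ / cos αₘ` for even `m` has the sign of `sin (mβ) sin (β - φ)`
(`height_gap`). So the maximum is attained at `φ = 0`, toward a vertex, for odd `m`, and at `φ = β`,
toward the midpoint of an edge, for even `m`; for `m ≥ 1` nowhere else. A negacyclic shift turns `u`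
by `2β` and hence preserves both kinds of directions (`negacyclicShift_vecMul`).
-/

namespace HeightProfile

open Matrix

/-! ### Codewords in polar coordinates -/

/-- The point of the unit circle at angle `θ`. -/
noncomputable def direction (θ : ℝ) : Fin 2 → ℝ := ![Real.cos θ, Real.sin θ]

theorem direction_add_int_mul_two_pi (θ : ℝ) (q : ℤ) :
    direction (θ + q * (2 * Real.pi)) = direction θ := by
  simp [direction, Real.cos_add_int_mul_two_pi, Real.sin_add_int_mul_two_pi]

theorem circlePoint_eq_direction {n : ℕ} {β : ℝ} (hβ : β = Real.pi / (2 * (n : ℝ))) (k : ℕ) :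
    circlePoint n k = direction (2 * k * β) := by
  have h : (k : ℝ) * (Real.pi / n) = 2 * k * β := by
    rw [hβ, mul_comm (2 : ℝ) (n : ℝ), ← div_div]; ring
  simp only [circlePoint, direction, h]

theorem two_mul_natCast_mul {n : ℕ} (hn : 0 < n) {β : ℝ} (hβ : β = Real.pi / (2 * (n : ℝ))) :
    2 * n * β = Real.pi := by
  have : (n : ℝ) ≠ 0 := by positivity
  rw [hβ]; field_simp

theorem exists_eq_smul_direction {u : Fin 2 → ℝ} (hu : u ≠ 0) :
    ∃ r θ : ℝ, 0 < r ∧ u = r • direction θ := by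
  have hz : (⟨u 0, u 1⟩ : ℂ) ≠ 0 := by
    intro h
    apply hu
    ext i
    fin_cases i
    · exact congrArg Complex.re h
    · exact congrArg Complex.im h
  refine ⟨‖(⟨u 0, u 1⟩ : ℂ)‖, Complex.arg ⟨u 0, u 1⟩, norm_pos_iff.mpr hz, ?_⟩
  ext i
  fin_cases i
  · simp [direction, Complex.norm_mul_cos_arg]
  · simp [direction, Complex.norm_mul_sin_arg]

/-- Every direction is within angle `β` of a vertex of the `2n`-gon: `k` is the nearest vertex,
`φ` the distance to it and `ε` the side on which the direction lies. -/
theorem exists_polar {β : ℝ} (hβ : 0 < β) {u : Fin 2 → ℝ} (hu : u ≠ 0) :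
    ∃ (r : ℝ) (k ε : ℤ) (φ : ℝ), 0 < r ∧ (ε = 1 ∨ ε = -1) ∧ 0 ≤ φ ∧ φ ≤ β ∧
      u = r • direction (2 * k * β + ε * φ) := by
  obtain ⟨r, θ, hr, rfl⟩ := exists_eq_smul_direction hu
  have h2β : θ / (2 * β) * (2 * β) = θ := by field_simp
  set k := round (θ / (2 * β)) with hk
  have hφ : |θ - 2 * k * β| ≤ β := by
    have h := abs_sub_round (θ / (2 * β))
    have h3 : θ - 2 * k * β = (θ / (2 * β) - k) * (2 * β) := by rw [sub_mul, h2β]; ring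
    rw [h3, abs_mul, abs_of_pos (by positivity : 0 < 2 * β)]
    nlinarith
  rcases le_total 0 (θ - 2 * k * β) with h | h
  · rw [abs_of_nonneg h] at hφ
    refine ⟨r, k, 1, θ - 2 * k * β, hr, Or.inl rfl, h, hφ, ?_⟩
    congr 2; push_cast; ring
  · rw [abs_of_nonpos h] at hφ
    refine ⟨r, k, -1, -(θ - 2 * k * β), hr, Or.inr rfl, by linarith, hφ, ?_⟩
    congr 2; push_cast; ring

theorem vecMul_direction {n : ℕ} {β : ℝ} (hβ : β = Real.pi / (2 * (n : ℝ))) (r θ : ℝ)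
    (j : Fin n) :
    vecMul (r • direction θ) (genMatrix n) j = r * Real.cos (θ - 2 * (j : ℕ) * β) := by
  simp [vecMul, dotProduct, Fin.sum_univ_two, genMatrix, circlePoint_eq_direction hβ, direction,
    Real.cos_sub]
  ring

theorem abs_cos_add_int_mul_pi (x : ℝ) (q : ℤ) : |Real.cos (x + q * Real.pi)| = |Real.cos x| := by
  rw [Real.cos_add_int_mul_pi, abs_mul, abs_zpow, abs_neg, abs_one, _root_.one_zpow, one_mul]

theorem negacyclicShift_vecMul {n : ℕ} {β : ℝ} (hβ : β = Real.pi / (2 * (n : ℝ))) (r θ : ℝ) :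
    negacyclicShift (vecMul (r • direction θ) (genMatrix n)) =
      vecMul (r • direction (θ + 2 * β)) (genMatrix n) := by
  ext j
  have hn : 0 < n := j.pos
  have hπ := two_mul_natCast_mul hn hβ
  rw [vecMul_direction hβ, negacyclicShift]
  split_ifs with h
  · rw [vecMul_direction hβ, h, Nat.cast_sub hn, ← mul_neg, ← Real.cos_add_pi, ← hπ]
    congr 2; push_cast; ring
  · rw [vecMul_direction hβ, Nat.cast_sub (Nat.one_le_iff_ne_zero.mpr h)]
    congr 2; push_cast; ring

theorem negacyclicShift_iterate_vecMul {n : ℕ} {β : ℝ} (hβ : β = Real.pi / (2 * (n : ℝ)))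
    (r θ : ℝ) (i : ℕ) :
    negacyclicShift^[i] (vecMul (r • direction θ) (genMatrix n)) =
      vecMul (r • direction (2 * i * β + θ)) (genMatrix n) := by
  induction i with
  | zero => simp
  | succ i ih =>
    rw [Function.iterate_succ_apply', ih, negacyclicShift_vecMul hβ]
    congr 3; push_cast; ring

/-! ### The entries of a codeword, sorted by magnitude -/

/-- The angle whose cosine is the `i`-th largest magnitude in a codeword whose direction has
distance `φ ≤ β` from the nearest vertex. -/
noncomputable def sortedAngle (β φ : ℝ) (i : ℕ) : ℝ :=
  if Even i then i * β + φ else (i + 1) * β - φ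

theorem le_sortedAngle {β φ : ℝ} (h0 : 0 ≤ φ) (h1 : φ ≤ β) (i : ℕ) :
    i * β ≤ sortedAngle β φ i := by
  unfold sortedAngle; split_ifs <;> linarith

theorem sortedAngle_le {β φ : ℝ} (h0 : 0 ≤ φ) (h1 : φ ≤ β) (i : ℕ) :
    sortedAngle β φ i ≤ (i + 1) * β := by
  unfold sortedAngle; split_ifs <;> linarith

theorem sortedAngle_monotone {β φ : ℝ} (h0 : 0 ≤ φ) (h1 : φ ≤ β) :
    Monotone (sortedAngle β φ) := by
  refine monotone_nat_of_le_succ fun i => (sortedAngle_le h0 h1 i).trans ?_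
  simpa using le_sortedAngle h0 h1 (i + 1)

theorem sortedAngle_le_pi_div_two {n : ℕ} {β φ : ℝ} (hβ : β = Real.pi / (2 * (n : ℝ)))
    (h0 : 0 ≤ φ) (h1 : φ ≤ β) (i : Fin n) : sortedAngle β φ i ≤ Real.pi / 2 := by
  have hi : ((i : ℕ) : ℝ) + 1 ≤ n := by exact_mod_cast i.isLt
  have := two_mul_natCast_mul i.pos hβ
  have := sortedAngle_le h0 h1 i
  nlinarith

/-- The integers `0, 1, -1, 2, -2, …`, in the order of their distance from a point of `[0, 1/2]`.
The first `n` of them represent all residues modulo `n`. -/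
def alternating (i : ℕ) : ℤ := if Even i then -(i / 2) else (i + 1) / 2

theorem alternating_injOn_mod {n i j : ℕ} (hi : i < n) (hj : j < n)
    (h : (n : ℤ) ∣ alternating i - alternating j) : i = j := by
  obtain ⟨q, hq⟩ := h
  have hq0 : q = 0 := by
    have h1 : (n : ℤ) * q < n * 1 := by
      rw [← hq]; unfold alternating; split_ifs <;> omega
    have h2 : (n : ℤ) * (-1) < n * q := by
      rw [← hq]; unfold alternating; split_ifs <;> omega
    have := lt_of_mul_lt_mul_left h1 (by positivity)
    have := lt_of_mul_lt_mul_left h2 (by positivity)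
    omega
  rw [hq0, mul_zero] at hq
  unfold alternating at hq
  split_ifs at hq with h1 h2 h2 <;> simp only [Nat.even_iff] at h1 h2 <;> omega

theorem cos_alternating (β φ : ℝ) (i : ℕ) :
    Real.cos (φ - 2 * alternating i * β) = Real.cos (sortedAngle β φ i) := by
  unfold alternating sortedAngle
  split_ifs with h
  · obtain ⟨s, rfl⟩ := h
    rw [show ((s + s : ℕ) : ℤ) / 2 = s by omega]
    congr 1; push_cast; ring
  · obtain ⟨s, rfl⟩ := Nat.not_even_iff_odd.mp h
    rw [show (((2 * s + 1 : ℕ) : ℤ) + 1) / 2 = s + 1 by omega, ← Real.cos_neg]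
    congr 1; push_cast; ring

/-- The sorted magnitudes of a codeword: the permutation is `i ↦ k + ε * alternating i` modulo
`n`. -/
theorem exists_perm_abs_vecMul {n : ℕ} {β φ r : ℝ} (hβ : β = Real.pi / (2 * (n : ℝ)))
    (hr : 0 < r) (h0 : 0 ≤ φ) (h1 : φ ≤ β) (k : ℤ) {ε : ℤ} (hε : ε = 1 ∨ ε = -1) :
    ∃ σ : Equiv.Perm (Fin n), ∀ i : Fin n,
      |vecMul (r • direction (2 * k * β + ε * φ)) (genMatrix n) (σ i)| =
        r * Real.cos (sortedAngle β φ i) := by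
  rcases Nat.eq_zero_or_pos n with rfl | hn
  · exact ⟨1, fun i => i.elim0⟩
  have hn' : (n : ℤ) ≠ 0 := by omega
  have hβ0 : 0 < β := by rw [hβ]; positivity
  -- The entry at `j` depends, up to sign, on `j` modulo `n` only.
  let f : Fin n → Fin n := fun i =>
    ⟨((k + ε * alternating i) % n).toNat, by
      have := Int.emod_nonneg (k + ε * alternating i) hn'
      have := Int.emod_lt_of_pos (k + ε * alternating i) (by omega : (0 : ℤ) < n)
      omega⟩
  have hf : ∀ i, ((f i : ℕ) : ℤ) = (k + ε * alternating i) % n := fun i =>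
    Int.toNat_of_nonneg (Int.emod_nonneg _ hn')
  have hinj : Function.Injective f := by
    intro i j hij
    have h : (k + ε * alternating i) % n = (k + ε * alternating j) % n := by
      rw [← hf, ← hf, hij]
    have hd := Int.ModEq.dvd (show k + ε * alternating j ≡ k + ε * alternating i [ZMOD n] from
      h.symm)
    refine Fin.ext (alternating_injOn_mod i.isLt j.isLt ?_)
    rcases hε with rfl | rfl
    · convert hd using 1; ring
    · refine dvd_neg.mp (?_ : (n : ℤ) ∣ -(alternating i - alternating j))
      rwa [show k + -1 * alternating i - (k + -1 * alternating j) =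
        -(alternating i - alternating j) by ring] at hd
  refine ⟨Equiv.ofBijective f (Finite.injective_iff_bijective.mp hinj), fun i => ?_⟩
  have hfi : ((f i : ℕ) : ℝ) = (k + ε * alternating i : ℤ) -
      n * ((k + ε * alternating i) / n : ℤ) := by
    have h := hf i
    rw [Int.emod_def] at h
    exact_mod_cast h
  have hang : 2 * k * β + ε * φ - 2 * ((f i : ℕ) : ℝ) * β =
      ε * (φ - 2 * alternating i * β) + ((k + ε * alternating i) / n : ℤ) * Real.pi := by
    rw [hfi, ← two_mul_natCast_mul hn hβ]; push_cast; ring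
  have hnn : 0 ≤ Real.cos (sortedAngle β φ i) :=
    Real.cos_nonneg_of_neg_pi_div_two_le_of_le
      (by have := le_sortedAngle h0 h1 i
          have : 0 ≤ ((i : ℕ) : ℝ) * β := by positivity
          linarith [Real.pi_pos])
      (sortedAngle_le_pi_div_two hβ h0 h1 i)
  rw [Equiv.ofBijective_apply, vecMul_direction hβ, hang, abs_mul, abs_of_pos hr,
    abs_cos_add_int_mul_pi]
  have hcos : Real.cos (ε * (φ - 2 * alternating i * β)) =
      Real.cos (φ - 2 * alternating i * β) := by
    rcases hε with rfl | rfl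
    · simp
    · rw [← Real.cos_neg]; congr 1; push_cast; ring
  rw [hcos, cos_alternating, abs_of_nonneg hnn]

/-- Only the last sorted entry of a codeword can vanish. -/
theorem cos_sortedAngle_pos {n : ℕ} {β φ : ℝ} (hβ : β = Real.pi / (2 * (n : ℝ)))
    (h0 : 0 ≤ φ) (h1 : φ ≤ β) {i : ℕ} (hi : i + 1 < n) : 0 < Real.cos (sortedAngle β φ i) := by
  have hn : 0 < n := by omega
  have hβ0 : 0 < β := by rw [hβ]; positivity
  have hi' : (i : ℝ) + 1 < n := by exact_mod_cast hi
  have := two_mul_natCast_mul hn hβ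
  have := sortedAngle_le h0 h1 i
  have := le_sortedAngle h0 h1 i
  have : 0 ≤ (i : ℝ) * β := by positivity
  exact Real.cos_pos_of_mem_Ioo ⟨by linarith [Real.pi_pos], by nlinarith⟩

theorem vecHeight_vecMul {n : ℕ} {β φ r : ℝ} (hβ : β = Real.pi / (2 * (n : ℝ)))
    (hr : 0 < r) (h0 : 0 ≤ φ) (h1 : φ ≤ β) (k : ℤ) {ε : ℤ} (hε : ε = 1 ∨ ε = -1)
    (m : Fin n) (hm : (m : ℕ) + 1 < n) :
    vecHeight m (vecMul (r • direction (2 * k * β + ε * φ)) (genMatrix n)) =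
      ENNReal.ofReal (Real.cos φ / Real.cos (sortedAngle β φ m)) := by
  obtain ⟨σ, hσ⟩ := exists_perm_abs_vecMul hβ hr h0 h1 k hε
  have hβ0 : 0 ≤ β := h0.trans h1
  have hsort : IsSortingPerm (vecMul (r • direction (2 * k * β + ε * φ)) (genMatrix n)) σ := by
    intro i j hij
    simp only [hσ]
    refine mul_le_mul_of_nonneg_left (Real.cos_le_cos_of_nonneg_of_le_pi ?_ ?_
      (sortedAngle_monotone h0 h1 hij)) hr.le
    · exact le_trans (by positivity) (le_sortedAngle h0 h1 i)
    · linarith [sortedAngle_le_pi_div_two hβ h0 h1 j, Real.pi_pos]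
  have hpos := cos_sortedAngle_pos hβ h0 h1 hm
  rw [vecHeight_eq m hsort, hσ, hσ, ← ENNReal.ofReal_div_of_pos (by positivity),
    mul_div_mul_left _ _ hr.ne']
  simp [sortedAngle]

/-! ### The dual code -/

theorem mem_negacyclicCode_iff {n : ℕ} (c : Fin n → ℝ) :
    c ∈ negacyclicCode n ↔ ∀ i, (genMatrix n).row i ⬝ᵥ c = 0 := by
  have key : ∑ j : Fin n,
      (c j : ℂ) * Complex.exp (Complex.I * ((Real.pi / n : ℝ) : ℂ)) ^ (j : ℕ) =
      (((genMatrix n).row 0 ⬝ᵥ c : ℝ) : ℂ) + (((genMatrix n).row 1 ⬝ᵥ c : ℝ) : ℂ) * Complex.I := by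
    simp only [dotProduct, Complex.ofReal_sum, Finset.sum_mul, ← Finset.sum_add_distrib]
    refine Finset.sum_congr rfl fun j _ => ?_
    rw [← Complex.exp_nat_mul, show ((j : ℕ) : ℂ) * (Complex.I * ((Real.pi / n : ℝ) : ℂ)) =
      (((j : ℕ) * (Real.pi / n) : ℝ) : ℂ) * Complex.I by push_cast; ring, Complex.exp_mul_I,
      ← Complex.ofReal_cos, ← Complex.ofReal_sin]
    simp [genMatrix, circlePoint]
    ring
  change _ = (0 : ℂ) ↔ _
  rw [key, Fin.forall_fin_two]
  constructor
  · intro h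
    exact ⟨by simpa using congrArg Complex.re h, by simpa using congrArg Complex.im h⟩
  · rintro ⟨h0, h1⟩
    simp [h0, h1]

theorem mem_dual_iff {n : ℕ} (x : Fin n → ℝ) :
    x ∈ dual (negacyclicCode n) ↔ ∃ u, vecMul u (genMatrix n) = x := by
  constructor
  · intro hx
    -- A functional that vanishes on the common kernel of two others is a combination of them.
    have h := mem_span_of_iInf_ker_le_ker
      (L := fun i => dotProductBilin ℝ ℝ ((genMatrix n).row i)) (K := dotProductBilin ℝ ℝ x)
      (by
        intro c hc
        simp only [Submodule.mem_iInf, LinearMap.mem_ker] at hc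
        exact hx c ((mem_negacyclicCode_iff c).mpr hc))
    obtain ⟨u, hu⟩ := (Submodule.mem_span_range_iff_exists_fun ℝ).mp h
    refine ⟨u, ?_⟩
    ext j
    have := LinearMap.congr_fun hu (Pi.single j 1)
    simpa [vecMul, dotProduct, Fin.sum_univ_two, Pi.single_apply] using this
  · rintro ⟨u, rfl⟩ c hc
    rw [← dotProduct_mulVec]
    have : genMatrix n *ᵥ c = 0 := funext ((mem_negacyclicCode_iff c).mp hc)
    rw [this, dotProduct_zero]

theorem vecMul_genMatrix_injective {n : ℕ} (hn : 2 ≤ n) {u : Fin 2 → ℝ}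
    (h : vecMul u (genMatrix n) = 0) : u = 0 := by
  have hn0 : (0 : ℝ) < n := by positivity
  have e0 := congrFun h ⟨0, by omega⟩
  have e1 := congrFun h ⟨1, by omega⟩
  have hs : 0 < Real.sin (Real.pi / n) := Real.sin_pos_of_pos_of_lt_pi (by positivity)
    (div_lt_self Real.pi_pos (by exact_mod_cast hn))
  simp [vecMul, dotProduct, Fin.sum_univ_two, genMatrix, circlePoint] at e0 e1
  rw [e0] at e1
  ext i
  fin_cases i
  · exact e0
  · simpa [hs.ne'] using e1

theorem isGeneratorMatrix_genMatrix {n : ℕ} (hn : 2 ≤ n) :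
    IsGeneratorMatrix (genMatrix n) (dual (negacyclicCode n)) := by
  constructor
  · rw [Fintype.linearIndependent_iff]
    intro u hu
    refine congrFun (vecMul_genMatrix_injective hn ?_)
    rw [← hu, vecMul_eq_sum]
    rfl
  · ext x
    rw [mem_dual_iff, Submodule.mem_span_range_iff_exists_fun]
    refine exists_congr fun u => ?_
    rw [vecMul_eq_sum]
    rfl

theorem isLinearCode_dual {n : ℕ} (hn : 2 ≤ n) :
    IsLinearCode n 2 (n - 1) (dual (negacyclicCode n)) := by
  have hG := isGeneratorMatrix_genMatrix hn
  have hn0 : (0 : ℝ) < n := by positivity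
  refine ⟨?_, ?_, ?_⟩
  · rw [← hG.2, finrank_span_eq_card hG.1, Fintype.card_fin]
  · -- The second row of `G` vanishes in its first entry only.
    have hval : ∀ j : Fin n, vecMul ![0, 1] (genMatrix n) j = Real.sin (j * (Real.pi / n)) := by
      intro j
      simp [vecMul, dotProduct, Fin.sum_univ_two, genMatrix, circlePoint]
    refine ⟨vecMul ![0, 1] (genMatrix n), (mem_dual_iff _).mpr ⟨_, rfl⟩, ?_, ?_⟩
    · intro h
      simpa using congrFun (vecMul_genMatrix_injective hn h) 1
    · have : (Finset.univ.filter fun j : Fin n => vecMul ![0, 1] (genMatrix n) j ≠ 0) =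
          Finset.univ.erase ⟨0, by omega⟩ := by
        ext j
        simp only [Finset.mem_filter, Finset.mem_univ, true_and, Finset.mem_erase, and_true, hval]
        refine not_congr ⟨fun h => ?_, fun h => by simp [h]⟩
        by_contra hj
        have hj0 : 0 < (j : ℕ) := Nat.pos_of_ne_zero fun h => hj (Fin.ext h)
        refine (Real.sin_pos_of_pos_of_lt_pi (by positivity) ?_).ne' h
        have : ((j : ℕ) : ℝ) < n := by exact_mod_cast j.isLt
        rw [← mul_div_assoc, div_lt_iff₀ hn0]
        nlinarith [Real.pi_pos]
      rw [hammingNorm, this]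
      simp
  · rintro w ⟨c, hc, hc0, rfl⟩
    obtain ⟨u, rfl⟩ := (mem_dual_iff c).mp hc
    have hu : u ≠ 0 := by rintro rfl; exact hc0 (zero_vecMul _)
    have hβ0 : 0 < Real.pi / (2 * (n : ℝ)) := by positivity
    obtain ⟨r, k, ε, φ, hr, hε, h0, h1, rfl⟩ := exists_polar hβ0 hu
    obtain ⟨σ, hσ⟩ := exists_perm_abs_vecMul rfl hr h0 h1 k hε
    have hsub : (Finset.univ.erase (⟨n - 1, by omega⟩ : Fin n)).map σ.toEmbedding ⊆
        Finset.univ.filter fun j => vecMul (r • direction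
          (2 * k * (Real.pi / (2 * (n : ℝ))) + ε * φ)) (genMatrix n) j ≠ 0 := by
      intro j hj
      obtain ⟨i, hi, rfl⟩ := Finset.mem_map.mp hj
      have hi' : (i : ℕ) + 1 < n := by
        have : (i : ℕ) ≠ n - 1 := fun h => (Finset.mem_erase.mp hi).1 (Fin.ext h)
        omega
      have hpos := mul_pos hr (cos_sortedAngle_pos rfl h0 h1 hi')
      rw [← hσ] at hpos
      simpa using hpos
    have := Finset.card_le_card hsub
    rw [Finset.card_map, Finset.card_erase_of_mem (Finset.mem_univ _), Finset.card_univ,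
      Fintype.card_fin] at this
    exact this

/-! ### The regular polygon -/

theorem circlePoint_add_self {n : ℕ} (hn : 0 < n) (k : ℕ) :
    circlePoint n (n + k) = -circlePoint n k := by
  have hn0 : (n : ℝ) ≠ 0 := by positivity
  have : ((n + k : ℕ) : ℝ) * (Real.pi / n) = k * (Real.pi / n) + Real.pi := by
    push_cast; field_simp; ring
  simp only [circlePoint, this, Real.cos_add_pi, Real.sin_add_pi, neg_cons, neg_empty]

theorem signedColumns_genMatrix {n : ℕ} (hn : 0 < n) :
    signedColumns (genMatrix n) = (Multiset.range (2 * n)).map (circlePoint n) := by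
  have hmap : ∀ f : ℕ → Fin 2 → ℝ,
      (Finset.univ.val.map fun j : Fin n => f j) = (Multiset.range n).map f := by
    intro f
    rw [Fin.univ_val_map, ← Multiset.coe_range, Multiset.map_coe, List.ofFn_eq_map,
      ← List.map_coe_finRange_eq_range, List.map_map]
    rfl
  rw [two_mul, Multiset.range_add, Multiset.map_add, Multiset.map_map]
  simp only [Function.comp_def, circlePoint_add_self hn]
  rw [← hmap, ← hmap]
  rfl

theorem circlePoint_injOn {n : ℕ} {i j : ℕ} (hi : i < 2 * n) (hj : j < 2 * n)
    (h : circlePoint n i = circlePoint n j) : i = j := by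
  have hn0 : (0 : ℝ) < n := by
    have : 0 < n := by omega
    exact_mod_cast this
  have hc : Real.cos (i * (Real.pi / n)) = Real.cos (j * (Real.pi / n)) := congrFun h 0
  have hs : Real.sin (i * (Real.pi / n)) = Real.sin (j * (Real.pi / n)) := congrFun h 1
  have h1 : Real.cos (i * (Real.pi / n) - j * (Real.pi / n)) = 1 := by
    rw [Real.cos_sub, hc, hs, ← sq, ← sq, Real.cos_sq_add_sin_sq]
  have hb : ∀ k : ℕ, k < 2 * n → (k : ℝ) * (Real.pi / n) < 2 * Real.pi := by
    intro k hk
    have : (k : ℝ) < 2 * n := by exact_mod_cast hk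
    rw [← mul_div_assoc, div_lt_iff₀ hn0]
    nlinarith [Real.pi_pos]
  have hi0 : 0 ≤ (i : ℝ) * (Real.pi / n) := by positivity
  have hj0 : 0 ≤ (j : ℝ) * (Real.pi / n) := by positivity
  have h2 := (Real.cos_eq_one_iff_of_lt_of_lt (by linarith [hb j hj]) (by linarith [hb i hi])).mp h1
  have h3 : (Real.pi / n) ≠ 0 := by positivity
  exact_mod_cast mul_right_cancel₀ h3 (sub_eq_zero.mp h2)

theorem exists_natCast_direction_eq {n : ℕ} (hn : 0 < n) {β : ℝ}
    (hβ : β = Real.pi / (2 * (n : ℝ))) (k : ℤ) (α : ℝ) :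
    ∃ k' : ℕ, k' < 2 * n ∧ direction (2 * k' * β + α) = direction (2 * k * β + α) := by
  have hπ := two_mul_natCast_mul hn hβ
  have hk0 := Int.emod_nonneg k (by omega : (2 * n : ℤ) ≠ 0)
  have hk1 := Int.emod_lt_of_pos k (by omega : (0 : ℤ) < 2 * n)
  have hk : (((k % (2 * n)).toNat : ℕ) : ℝ) = k - 2 * n * (k / (2 * n) : ℤ) := by
    have h := Int.toNat_of_nonneg hk0
    rw [Int.emod_def] at h
    rw [Int.emod_def]
    exact_mod_cast h
  refine ⟨(k % (2 * n)).toNat, by omega, ?_⟩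
  rw [hk, ← direction_add_int_mul_two_pi (2 * ((k : ℝ) - _) * β + α) (k / (2 * n)), ← hπ]
  congr 1; ring

theorem pointsTowardVertex_iff {n : ℕ} (hn : 0 < n) {β : ℝ} (hβ : β = Real.pi / (2 * (n : ℝ)))
    (u : Fin 2 → ℝ) :
    PointsTowardVertex n u ↔ ∃ (r : ℝ) (k : ℤ), 0 < r ∧ u = r • direction (2 * k * β) := by
  constructor
  · rintro ⟨k, -, r, hr, rfl⟩
    exact ⟨r, k, hr, by rw [circlePoint_eq_direction hβ]; push_cast; rfl⟩
  · rintro ⟨r, k, hr, rfl⟩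
    obtain ⟨k', hk', h⟩ := exists_natCast_direction_eq hn hβ k 0
    rw [add_zero, add_zero] at h
    exact ⟨k', hk', r, hr, by rw [circlePoint_eq_direction hβ, h]⟩

theorem midpoint_circlePoint {n : ℕ} {β : ℝ} (hβ : β = Real.pi / (2 * (n : ℝ))) (k : ℕ) :
    midpoint ℝ (circlePoint n k) (circlePoint n (k + 1)) =
      Real.cos β • direction (2 * k * β + β) := by
  have h : ∀ θ : ℝ, midpoint ℝ (direction (θ - β)) (direction (θ + β)) =
      Real.cos β • direction θ := by
    intro θ
    rw [midpoint_eq_smul_add]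
    ext i
    fin_cases i
    · simp [direction, Real.cos_add, Real.cos_sub]; ring
    · simp [direction, Real.sin_add, Real.sin_sub]; ring
  rw [circlePoint_eq_direction hβ, circlePoint_eq_direction hβ, ← h]
  congr 2 <;> push_cast <;> ring

theorem pointsTowardEdgeMidpoint_iff {n : ℕ} (hn : 2 ≤ n) {β : ℝ}
    (hβ : β = Real.pi / (2 * (n : ℝ))) (u : Fin 2 → ℝ) :
    PointsTowardEdgeMidpoint n u ↔
      ∃ (r : ℝ) (k : ℤ), 0 < r ∧ u = r • direction (2 * k * β + β) := by
  have hn0 : 0 < n := by omega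
  have hβ0 : 0 < β := by rw [hβ]; positivity
  have hπ := two_mul_natCast_mul hn0 hβ
  have hn2 : (2 : ℝ) ≤ n := by exact_mod_cast hn
  have hcos : 0 < Real.cos β :=
    Real.cos_pos_of_mem_Ioo ⟨by linarith [Real.pi_pos], by nlinarith⟩
  constructor
  · rintro ⟨k, -, t, ht, rfl⟩
    refine ⟨t * Real.cos β, k, by positivity, ?_⟩
    rw [midpoint_circlePoint hβ, smul_smul]; push_cast; rfl
  · rintro ⟨r, k, hr, rfl⟩
    obtain ⟨k', hk', h⟩ := exists_natCast_direction_eq hn0 hβ k β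
    refine ⟨k', hk', r / Real.cos β, by positivity, ?_⟩
    rw [midpoint_circlePoint hβ, smul_smul, div_mul_cancel₀ _ hcos.ne', h]

/-! ### Maximizing the height -/

theorem cos_div_cos_sub {φ A : ℝ} (hA : 0 < Real.cos A) (hB : 0 < Real.cos (A - φ)) :
    1 / Real.cos A - Real.cos φ / Real.cos (A - φ) =
      Real.sin A * Real.sin φ / (Real.cos A * Real.cos (A - φ)) := by
  rw [div_sub_div _ _ hA.ne' hB.ne', Real.cos_sub]; congr 1; ring

theorem cos_div_cos_add {β φ B : ℝ} (hA : 0 < Real.cos (B + β)) (hB : 0 < Real.cos (B + φ)) :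
    Real.cos β / Real.cos (B + β) - Real.cos φ / Real.cos (B + φ) =
      Real.sin B * Real.sin (β - φ) / (Real.cos (B + β) * Real.cos (B + φ)) := by
  rw [div_sub_div _ _ hA.ne' hB.ne', Real.cos_add, Real.cos_add, Real.sin_sub]; congr 1; ring

/-- The distance from the nearest vertex at which the `m`-height is largest. -/
noncomputable def optimalDistance (β : ℝ) (m : ℕ) : ℝ := if Even m then β else 0

theorem sortedAngle_optimalDistance (β : ℝ) (m : ℕ) :
    sortedAngle β (optimalDistance β m) m = (m + 1) * β := by
  unfold sortedAngle optimalDistance; split_ifs <;> ring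

theorem optimalDistance_mem {β : ℝ} (hβ : 0 ≤ β) (m : ℕ) :
    0 ≤ optimalDistance β m ∧ optimalDistance β m ≤ β := by
  unfold optimalDistance; split_ifs <;> simp [hβ]

/-- The `m`-height at distance `φ` from the nearest vertex is at most that at the optimal distance,
with equality for `m ≥ 1` at the optimal distance only. -/
theorem height_gap {n : ℕ} {β φ : ℝ} (hβ : β = Real.pi / (2 * (n : ℝ))) (h0 : 0 ≤ φ)
    (h1 : φ ≤ β) {m : ℕ} (hm : m + 1 < n) :
    Real.cos φ / Real.cos (sortedAngle β φ m) ≤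
        Real.cos (optimalDistance β m) / Real.cos ((m + 1) * β) ∧
      (1 ≤ m → Real.cos φ / Real.cos (sortedAngle β φ m) =
        Real.cos (optimalDistance β m) / Real.cos ((m + 1) * β) → φ = optimalDistance β m) := by
  have hn : 0 < n := by omega
  have hβ0 : 0 < β := by rw [hβ]; positivity
  have hπ := two_mul_natCast_mul hn hβ
  have hm' : (m : ℝ) + 1 < n := by exact_mod_cast hm
  have hlt : ((m : ℝ) + 1) * β < Real.pi / 2 := by nlinarith
  have hm0 : 0 ≤ (m : ℝ) * β := by positivity
  have hA : 0 < Real.cos ((m + 1) * β) :=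
    Real.cos_pos_of_mem_Ioo ⟨by nlinarith [Real.pi_pos], hlt⟩
  have hB := cos_sortedAngle_pos hβ h0 h1 hm
  by_cases he : Even m
  · simp only [optimalDistance, sortedAngle, if_pos he] at hB ⊢
    have e : ((m : ℝ) + 1) * β = m * β + β := by ring
    rw [e] at hA ⊢
    have hgap := cos_div_cos_add hA hB
    have hs : 0 ≤ Real.sin (β - φ) :=
      Real.sin_nonneg_of_nonneg_of_le_pi (by linarith) (by nlinarith)
    have hs' : 0 ≤ Real.sin (m * β) := Real.sin_nonneg_of_nonneg_of_le_pi hm0 (by nlinarith)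
    refine ⟨?_, fun hm1 heq => ?_⟩
    · rw [← sub_nonneg, hgap]; positivity
    · have hm1' : (1 : ℝ) ≤ m := by exact_mod_cast hm1
      have hsm : 0 < Real.sin (m * β) :=
        Real.sin_pos_of_pos_of_lt_pi (by positivity) (by nlinarith)
      by_contra hne
      have : φ < β := lt_of_le_of_ne h1 hne
      have hs2 : 0 < Real.sin (β - φ) :=
        Real.sin_pos_of_pos_of_lt_pi (by linarith) (by nlinarith)
      rw [heq, sub_self] at hgap
      have : 0 < Real.sin (m * β) * Real.sin (β - φ) /
        (Real.cos (m * β + β) * Real.cos (m * β + φ)) := by positivity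
      linarith
  · simp only [optimalDistance, sortedAngle, if_neg he, Real.cos_zero] at hB ⊢
    have hgap := cos_div_cos_sub hA hB
    have hs : 0 ≤ Real.sin φ :=
      Real.sin_nonneg_of_nonneg_of_le_pi h0 (by nlinarith)
    have hsm : 0 < Real.sin ((m + 1) * β) :=
      Real.sin_pos_of_pos_of_lt_pi (by positivity) (by linarith [Real.pi_pos])
    refine ⟨?_, fun _ heq => ?_⟩
    · rw [← sub_nonneg, hgap]; positivity
    · by_contra hne
      have hφ : 0 < φ := lt_of_le_of_ne h0 (Ne.symm hne)
      have hs2 : 0 < Real.sin φ := Real.sin_pos_of_pos_of_lt_pi hφ (by nlinarith)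
      rw [heq, sub_self] at hgap
      have : 0 < Real.sin ((m + 1) * β) * Real.sin φ /
        (Real.cos ((m + 1) * β) * Real.cos ((m + 1) * β - φ)) := by positivity
      linarith

theorem direction_ne_zero (θ : ℝ) : direction θ ≠ 0 := by
  intro h
  have hc : Real.cos θ = 0 := congrFun h 0
  have hs : Real.sin θ = 0 := congrFun h 1
  simpa [hc, hs] using Real.cos_sq_add_sin_sq θ

theorem vecMul_direction_mem {n : ℕ} (hn : 2 ≤ n) {r : ℝ} (hr : 0 < r) (θ : ℝ) :
    vecMul (r • direction θ) (genMatrix n) ∈ dual (negacyclicCode n) ∧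
      vecMul (r • direction θ) (genMatrix n) ≠ 0 :=
  ⟨(mem_dual_iff _).mpr ⟨_, rfl⟩, fun h =>
    smul_ne_zero hr.ne' (direction_ne_zero θ) (vecMul_genMatrix_injective hn h)⟩

theorem codeHeight_dual {n : ℕ} (hn : 2 ≤ n) {β : ℝ} (hβ : β = Real.pi / (2 * (n : ℝ)))
    (m : Fin n) (hm : (m : ℕ) + 1 < n) :
    codeHeight m (dual (negacyclicCode n)) =
      ENNReal.ofReal (Real.cos (optimalDistance β m) / Real.cos ((m + 1) * β)) := by
  have hβ0 : 0 < β := by rw [hβ]; positivity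
  apply le_antisymm
  · refine iSup₂_le fun c hc => ?_
    obtain ⟨u, rfl⟩ := (mem_dual_iff c).mp hc.1
    have hu : u ≠ 0 := by rintro rfl; exact hc.2 (zero_vecMul _)
    obtain ⟨r, k, ε, φ, hr, hε, h0, h1, rfl⟩ := exists_polar hβ0 hu
    rw [vecHeight_vecMul hβ hr h0 h1 k hε m hm]
    exact ENNReal.ofReal_le_ofReal (height_gap hβ h0 h1 hm).1
  · have ho := optimalDistance_mem hβ0.le m
    have h := vecHeight_vecMul hβ one_pos ho.1 ho.2 0 (Or.inl rfl) m hm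
    rw [sortedAngle_optimalDistance] at h
    rw [← h]
    exact le_iSup₂_of_le _ (vecMul_direction_mem hn one_pos _) le_rfl

theorem isExtremal_of_optimalDistance {n : ℕ} (hn : 2 ≤ n) {β r : ℝ}
    (hβ : β = Real.pi / (2 * (n : ℝ))) (hr : 0 < r) (k : ℤ) (m : Fin n) (hm : (m : ℕ) + 1 < n) :
    IsExtremal m (dual (negacyclicCode n))
      (vecMul (r • direction (2 * k * β + optimalDistance β m)) (genMatrix n)) := by
  have hβ0 : 0 < β := by rw [hβ]; positivity
  have ho := optimalDistance_mem hβ0.le m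
  have hmem := vecMul_direction_mem hn hr (2 * k * β + optimalDistance β m)
  refine ⟨hmem.1, hmem.2, ?_⟩
  have h := vecHeight_vecMul hβ hr ho.1 ho.2 k (Or.inl rfl) m hm
  rw [sortedAngle_optimalDistance, Int.cast_one, one_mul] at h
  rw [h, codeHeight_dual hn hβ m hm]

/-- For `m ≥ 1` the distance that maximizes the `m`-height is unique. (For `m = 0` every height
is `1`.) -/
theorem isExtremal_iff {n : ℕ} (hn : 2 ≤ n) {β : ℝ} (hβ : β = Real.pi / (2 * (n : ℝ)))
    (m : Fin n) (hm : (m : ℕ) + 1 < n) (hm1 : 1 ≤ (m : ℕ)) (u : Fin 2 → ℝ) :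
    IsExtremal m (dual (negacyclicCode n)) (vecMul u (genMatrix n)) ↔
      ∃ (r : ℝ) (k : ℤ), 0 < r ∧ u = r • direction (2 * k * β + optimalDistance β m) := by
  have hβ0 : 0 < β := by rw [hβ]; positivity
  constructor
  · rintro ⟨-, hne, hext⟩
    have hu : u ≠ 0 := by rintro rfl; exact hne (zero_vecMul _)
    obtain ⟨r, k, ε, φ, hr, hε, h0, h1, rfl⟩ := exists_polar hβ0 hu
    have ho := optimalDistance_mem hβ0.le m
    have hpos : 0 ≤ Real.cos φ / Real.cos (sortedAngle β φ m) := by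
      have hs0 := cos_sortedAngle_pos hβ h0 h1 (i := 0) (by omega)
      have := cos_sortedAngle_pos hβ h0 h1 hm
      simp only [sortedAngle, Even.zero, if_true, Nat.cast_zero, zero_mul, zero_add] at hs0
      positivity
    rw [vecHeight_vecMul hβ hr h0 h1 k hε m hm, codeHeight_dual hn hβ m hm,
      ENNReal.ofReal_eq_ofReal_iff hpos (hpos.trans (height_gap hβ h0 h1 hm).1)] at hext
    have hφ := (height_gap hβ h0 h1 hm).2 hm1 hext
    rcases hε with rfl | rfl
    · exact ⟨r, k, hr, by rw [hφ]; simp⟩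
    · by_cases he : Even (m : ℕ)
      · -- The midpoint of the edge before vertex `k` is that of the edge after vertex `k - 1`.
        refine ⟨r, k - 1, hr, ?_⟩
        rw [hφ, optimalDistance, if_pos he]
        congr 2; push_cast; ring
      · refine ⟨r, k, hr, ?_⟩
        rw [hφ, optimalDistance, if_neg he]
        simp
  · rintro ⟨r, k, hr, rfl⟩
    exact isExtremal_of_optimalDistance hn hβ hr k m hm

end HeightProfile

theorem mainTheorem12 (n : ℕ) (hn : 2 < n) (β : ℝ) (hβ : β = Real.pi / (2 * (n : ℝ))) :
    IsLinearCode n 2 (n - 1) (dual (negacyclicCode n)) ∧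
    IsGeneratorMatrix (genMatrix n) (dual (negacyclicCode n)) ∧
    signedColumns (genMatrix n) = (Multiset.range (2 * n)).map (circlePoint n) ∧
    (signedColumns (genMatrix n)).Nodup ∧
    ∀ m : Fin n, (m : ℕ) + 1 < n →
      -- the `m`-height of the dual code
      (Odd (m : ℕ) →
        codeHeight m (dual (negacyclicCode n)) =
          ENNReal.ofReal (1 / Real.cos (((m : ℝ) + 1) * β))) ∧
      (Even (m : ℕ) →
        codeHeight m (dual (negacyclicCode n)) =
          ENNReal.ofReal (Real.cos β / Real.cos (((m : ℝ) + 1) * β))) ∧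
      -- two specific codewords and all their negacyclic shifts are extremal
      (Odd (m : ℕ) → ∀ i : ℕ,
        IsExtremal m (dual (negacyclicCode n))
          (negacyclicShift^[i] (Matrix.vecMul ![1, 0] (genMatrix n)))) ∧
      (Even (m : ℕ) → ∀ i : ℕ,
        IsExtremal m (dual (negacyclicCode n))
          (negacyclicShift^[i] (Matrix.vecMul ![Real.cos β, Real.sin β] (genMatrix n)))) ∧
      -- for `m ≥ 1`, the directions of all the extremal codewords
      (1 ≤ (m : ℕ) → ∀ u : Fin 2 → ℝ,
        (Odd (m : ℕ) →
          (IsExtremal m (dual (negacyclicCode n)) (Matrix.vecMul u (genMatrix n)) ↔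
            PointsTowardVertex n u)) ∧
        (Even (m : ℕ) →
          (IsExtremal m (dual (negacyclicCode n)) (Matrix.vecMul u (genMatrix n)) ↔
            PointsTowardEdgeMidpoint n u))) := by
  have hn2 : 2 ≤ n := hn.le
  have hn0 : 0 < n := by omega
  refine ⟨isLinearCode_dual hn2, isGeneratorMatrix_genMatrix hn2, signedColumns_genMatrix hn0, ?_,
    fun m hm => ?_⟩
  · rw [signedColumns_genMatrix hn0]
    exact (Multiset.nodup_range _).map_on fun i hi j hj h =>
      circlePoint_injOn (Multiset.mem_range.mp hi) (Multiset.mem_range.mp hj) h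
  have hodd : Odd (m : ℕ) → optimalDistance β m = 0 := fun h =>
    if_neg (Nat.not_even_iff_odd.mpr h)
  have heven : Even (m : ℕ) → optimalDistance β m = β := fun h => if_pos h
  have hext := fun k : ℕ => isExtremal_of_optimalDistance hn2 hβ one_pos k m hm
  refine ⟨fun h => ?_, fun h => ?_, fun h i => ?_, fun h i => ?_, fun hm1 u =>
    ⟨fun h => ?_, fun h => ?_⟩⟩
  · rw [codeHeight_dual hn2 hβ m hm, hodd h, Real.cos_zero]
  · rw [codeHeight_dual hn2 hβ m hm, heven h]
  · have hu : (![1, 0] : Fin 2 → ℝ) = (1 : ℝ) • direction 0 := by simp [direction]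
    rw [hu, negacyclicShift_iterate_vecMul hβ]
    simpa only [hodd h, Int.cast_natCast] using hext i
  · have hu : (![Real.cos β, Real.sin β] : Fin 2 → ℝ) = (1 : ℝ) • direction β := by
      simp [direction]
    rw [hu, negacyclicShift_iterate_vecMul hβ]
    simpa only [heven h, Int.cast_natCast] using hext i
  · rw [isExtremal_iff hn2 hβ m hm hm1, hodd h, pointsTowardVertex_iff hn0 hβ]
    simp only [add_zero]
  · rw [isExtremal_iff hn2 hβ m hm hm1, heven h, pointsTowardEdgeMidpoint_iff hn2 hβ]
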